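/- **Setting.** Let $\Omega\subset\mathbb R^2$ be open and bounded, $\Omega_{\rm a}\subset\Omega$ open, and $\Omega_{\rm c}=\Omega\setminus\overline{\Omega_{\rm a}}$. Assume that $\Omega_{\rm c}$ is a polygonal region with a triangulation $\mathcal T$ whose vertices lie in $\mathbb Z^2$: $\mathcal T$ is a finite set of non-degenerate closed triangles with vertices in $\mathbb Z^2$ and pairwise disjoint interiors, and $\Omega_{\rm c}$ is the interior of their union. Let $\mathcal R\subset\mathbb Z^2\setminus\{0\}$ be finite, write $(i,i+r)$ for the open segment between $i$ and $i+r$, and assume that for all $r\in\mathcal R$ and $i\in\mathbb Z^2$ with $(i,i+r)\cap\overline{\Omega_{\rm c}}\neq\emptyset$ one has $i,i+r\in\Omega$. Let $$\mathcal B=\{b=(i,i+r):\ r\in\mathcal R,\ i\in\Omega\cap\mathbb Z^2,\ i+r\in\Omega\cap\mathbb Z^2\}$$ be the set of bonds, a bond being recorded together with its $i$ and $r$ (so $(i,i+r)$ and $(i+r,i)$ count separately if $\pm r\in\mathcal R$). Let $\varphi$ be a real function (the two-body potential), $\phi(z)=\varphi(|z|)$ for $z\in\mathbb R^2$, and let $y$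 be a deformation with values in $\mathbb R^2$, given on $\overline{\Omega_{\rm c}}$ and at the lattice points of $\Omega$, and affine on every $T\in\mathcal T$ (so $y\in\mathcal P_1(\mathcal T)$ on $\overline{\Omega_{\rm c}}$). Put $D_ry(x)=\lim_{\varepsilon\to0}\frac{y(x+\varepsilon r)-y(x)}{\varepsilon}$, and for $b=(i,i+r)$ put $$\langle f\rangle_b=\int_0^1 f(i+\lambda r)\,d\lambda,\qquad \chi_{\Omega_{\rm c}}(x)=\lim_{\rho\to0}\frac{|\Omega_{\rm c}\cap B_\rho(x)|}{|B_\rho(x)|},$$ $$e_b(y)=\phi(y_{i+r}-y_i),\qquad c_b(y)=\langle\chi_{\Omega_{\rm c}}\,\phi(D_ry)\rangle_b,$$ where the integrand of $c_b$ is $0$ outside $\overline{\Omega_{\rm c}}$. The ECC energy is $$E^{\rm ecc}(y)=\sum_{b\in\mathcal B,\ b\not\subset\Omega_{\rm c}}e_b(y)+\sum_{b\in\mathcal B,\ b\subset\Omega_{\rm c}}\langle\phi(D_ry)\rangle_b.$$ **Theorem.** The contributions $c_b(y)$, $b\in\mathcal B$, are well defined (the integrand is integrable over $b$), with $c_b(y)=\langle\phi(D_ry)\rangle_b$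 if $b\subset\Omega_{\rm c}$. The Cauchy–Born energy $$E_{\rm c}(y)=\int_{\Omega_{\rm c}}\sum_{r\in\mathcal R}\phi(D_ry)\,d\Omega=\sum_{T\in\mathcal T}\sum_{r\in\mathcal R}|T|\,\phi(D_ry|_T)$$ is well defined (the integrand is integrable and the two expressions agree), and $$E^{\rm ecc}(y)=\sum_{b\in\mathcal B,\ b\not\subset\Omega_{\rm c}}\bigl(e_b(y)-c_b(y)\bigr)+E_{\rm c}(y).$$ Moreover, $E^{\rm ecc}(y)$ can be computed at a cost proportional to the number of bonds not contained in $\Omega_{\rm c}$ plus the number of triangles: for given $\Omega,\Omega_{\rm a},\mathcal T,\mathcal R$ there is a straight-line computation, the same for all $\varphi$ and $y$, whose inputs are fixed real constants (depending on the geometry only) and coordinates of the values of $y$ at lattice points, whose operations are additions, subtractions, multiplications and evaluations $z\mapsto\varphi(|z|)$, which returns $E^{\rm ecc}(y)$ and performs at most $$20\,\bigl(\#\{b\in\mathcal B:\ b\not\subset\Omega_{\rm c}\}+\#\mathcal R\cdot\#\mathcal T\bigr)$$ operations. -/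

import Mathlib

open MeasureTheory Filter Topology

noncomputable section

namespace ECC

/-- The plane `ℝ²` with its Euclidean norm. -/
abbrev Plane := EuclideanSpace ℝ (Fin 2)

/-- The lattice `ℤ²`. -/
abbrev Lattice := Fin 2 → ℤ

/-- The reference position `x_i = i ∈ ℝ²` of the lattice point `i ∈ ℤ²`. -/
def site (i : Lattice) : Plane := WithLp.toLp 2 fun k => (i k : ℝ)

/-- The closed triangle (convex hull) spanned by a finite set of lattice points. -/
def tri (T : Finset Lattice) : Set Plane := convexHull ℝ (site '' (T : Set Lattice))

/-- `𝒯` is a triangulation of the polygonal region `ω`: finitely many non-degenerate triangles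
with lattice vertices (a triangle being given by its set of three vertices), which do not overlap
and fill `ω`. In particular this is the case for every conforming (edge-to-edge) triangulation,
but hanging nodes are not excluded. -/
structure IsTriangulation (𝒯 : Finset (Finset Lattice)) (ω : Set Plane) : Prop where
  card_eq : ∀ T ∈ 𝒯, T.card = 3
  nondegenerate : ∀ T ∈ 𝒯, AffineIndependent ℝ fun v : T => site v
  nonoverlapping : ∀ T ∈ 𝒯, ∀ T' ∈ 𝒯, T ≠ T' → Disjoint (interior (tri T)) (interior (tri T'))
  region_eq : ω = interior (⋃ T ∈ 𝒯, tri T)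

/-- `y` is a continuous piecewise affine function on the triangulated region: it agrees with an
affine map on each closed triangle (so it is continuous on their union). Its values elsewhere are
unrestricted. -/
def IsP1 (𝒯 : Finset (Finset Lattice)) (y : Plane → Plane) : Prop :=
  ∀ T ∈ 𝒯, ∃ A : Plane →ᵃ[ℝ] Plane, Set.EqOn y A (tri T)

/-- The open segment `(i, i + r)`; a bond `b = (i, i + r)` is recorded as the pair `(i, r)`. -/
def seg (b : Lattice × Lattice) : Set Plane := openSegment ℝ (site b.1) (site (b.1 + b.2))

/-- The collection of all bonds `(i, i + r)` with `r ∈ R` and `i, i + r ∈ Ω ∩ ℤ²`. -/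
def bonds (Ω : Set Plane) (R : Finset Lattice) : Set (Lattice × Lattice) :=
  {b | b.2 ∈ R ∧ site b.1 ∈ Ω ∧ site (b.1 + b.2) ∈ Ω}

/-- The bonds contained in `Ωc`. -/
def innerBonds (Ω Ωc : Set Plane) (R : Finset Lattice) : Set (Lattice × Lattice) :=
  {b ∈ bonds Ω R | seg b ⊆ Ωc}

/-- The bonds not contained in `Ωc`. -/
def outerBonds (Ω Ωc : Set Plane) (R : Finset Lattice) : Set (Lattice × Lattice) :=
  {b ∈ bonds Ω R | ¬ seg b ⊆ Ωc}

/-- The directional derivative `D_r y (x) = lim_{ε → 0} (y (x + ε r) - y (x)) / ε`. -/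
def dirDeriv (r : Lattice) (y : Plane → Plane) (x : Plane) : Plane := lineDeriv ℝ y x (site r)

/-- The point `(1 - t) i + t (i + r)` of the bond `(i, i + r)`. -/
def bondPoint (b : Lattice × Lattice) (t : ℝ) : Plane :=
  (1 - t) • site b.1 + t • site (b.1 + b.2)

/-- The average over a bond. -/
def bondAverage (b : Lattice × Lattice) (f : Plane → ℝ) : ℝ :=
  ∫ t in (0 : ℝ)..1, f (bondPoint b t)

/-- The characteristic function of a polygonal set, `lim_{ρ → 0} |ω ∩ B_ρ(x)| / |B_ρ(x)|`. -/
def chi (ω : Set Plane) (x : Plane) : ℝ :=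
  limUnder (𝓝[>] (0 : ℝ)) fun ρ =>
    volume.real (ω ∩ Metric.ball x ρ) / volume.real (Metric.ball x ρ)

/-- The exact contribution `e_b(y) = φ(|y_{i+r} - y_i|)` of the bond `b = (i, i + r)`. -/
def exactContrib (φ : ℝ → ℝ) (y : Plane → Plane) (b : Lattice × Lattice) : ℝ :=
  φ ‖y (site (b.1 + b.2)) - y (site b.1)‖

/-- The continuum contribution of a bond `b` contained in the continuum region: the average over
`b` of `φ(|D_r y|)`. -/
def innerContContrib (φ : ℝ → ℝ) (y : Plane → Plane) (b : Lattice × Lattice) : ℝ :=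
  bondAverage b fun x => φ ‖dirDeriv b.2 y x‖

/-- The integrand `χ_{Ωc} φ(|D_r y|)` of the extended continuum contribution of `b`. It vanishes
outside the closure of `Ωc`, whatever `y` is there. -/
def contDensity (Ωc : Set Plane) (φ : ℝ → ℝ) (y : Plane → Plane) (b : Lattice × Lattice)
    (x : Plane) : ℝ :=
  chi Ωc x * φ ‖dirDeriv b.2 y x‖

/-- The continuum contribution `c_b(y)` of an arbitrary bond `b`: the average over `b` of
`χ_{Ωc} φ(|D_r y|)`. -/
def contContrib (Ωc : Set Plane) (φ : ℝ → ℝ) (y : Plane → Plane) (b : Lattice × Lattice) : ℝ :=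
  bondAverage b (contDensity Ωc φ y b)

/-- The energy of the ECC method: exact contributions of the bonds not contained in `Ωc`, plus
continuum contributions of the bonds contained in `Ωc`. -/
def eccEnergy (Ω Ωc : Set Plane) (R : Finset Lattice) (φ : ℝ → ℝ) (y : Plane → Plane) : ℝ :=
  (∑ᶠ b ∈ outerBonds Ω Ωc R, exactContrib φ y b) + ∑ᶠ b ∈ innerBonds Ω Ωc R, innerContContrib φ y b

/-- The Cauchy--Born energy density `∑_{r ∈ R} φ(|D_r y|)`. -/
def cauchyBornDensity (R : Finset Lattice) (φ : ℝ → ℝ) (y : Plane → Plane) (x : Plane) : ℝ :=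
  ∑ r ∈ R, φ ‖dirDeriv r y x‖

/-- The Cauchy--Born continuum energy, as an integral over `Ωc`. -/
def contEnergy (Ωc : Set Plane) (R : Finset Lattice) (φ : ℝ → ℝ) (y : Plane → Plane) : ℝ :=
  ∫ x in Ωc, cauchyBornDensity R φ y x

/-- The barycenter of a triangle. -/
def barycenter (T : Finset Lattice) : Plane := (3 : ℝ)⁻¹ • ∑ v ∈ T, site v

/-- The Cauchy--Born continuum energy, assembled over the triangles:
`∑_T ∑_r |T| φ(|D_r y|_T|)`. The constant value `D_r y|_T` is taken at the barycenter of `T`. -/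
def contEnergyTri (𝒯 : Finset (Finset Lattice)) (R : Finset Lattice) (φ : ℝ → ℝ)
    (y : Plane → Plane) : ℝ :=
  ∑ T ∈ 𝒯, ∑ r ∈ R, volume.real (tri T) * φ ‖dirDeriv r y (barycenter T)‖

/-- Straight-line computations with real numbers: the inputs are real constants and the
coordinates of the positions `y_i` at lattice points, the operations are addition, subtraction,
multiplication and the evaluation of the two-body potential at a vector of the plane. -/
inductive Computation : Type
  | const (a : ℝ) : Computation
  | coord (i : Lattice) (k : Fin 2) : Computation
  | add (p q : Computation) : Computation
  | sub (p q : Computation) : Computation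
  | mul (p q : Computation) : Computation
  | potential (p q : Computation) : Computation

/-- The value computed for the potential `φ` and the deformation `y`. -/
def Computation.value (φ : ℝ → ℝ) (y : Plane → Plane) : Computation → ℝ
  | .const a => a
  | .coord i k => y (site i) k
  | .add p q => p.value φ y + q.value φ y
  | .sub p q => p.value φ y - q.value φ y
  | .mul p q => p.value φ y * q.value φ y
  | .potential p q => φ ‖(!₂[p.value φ y, q.value φ y] : Plane)‖

/-- The number of operations performed. -/
def Computation.cost : Computation → ℕ
  | .const _ => 0
  | .coord _ _ => 0
  | .add p q => p.cost + q.cost + 1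
  | .sub p q => p.cost + q.cost + 1
  | .mul p q => p.cost + q.cost + 1
  | .potential p q => p.cost + q.cost + 1

/-- A bounded region has finitely many bonds, so that the sums over bonds are finite sums. -/
theorem bonds_finite {Ω : Set Plane} (hΩ : Bornology.IsBounded Ω) (R : Finset Lattice) :
    (bonds Ω R).Finite := by
  obtain ⟨M, hM⟩ := hΩ.exists_norm_le
  have hI : {i : Lattice | site i ∈ Ω}.Finite := by
    refine (Set.finite_Icc (fun _ => -⌈M⌉ : Lattice) (fun _ => ⌈M⌉)).subset fun i hi => ?_
    have h : ∀ k, |(i k : ℝ)| ≤ (⌈M⌉ : ℝ) := fun k =>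
      ((PiLp.norm_apply_le (site i) k).trans (hM _ hi)).trans (Int.le_ceil M)
    exact ⟨fun k => by have := (abs_le.1 (h k)).1; exact_mod_cast this,
      fun k => by have := (abs_le.1 (h k)).2; exact_mod_cast this⟩
  exact (hI.prod R.finite_toSet).subset fun b hb => ⟨hb.2.1, hb.1⟩

end ECC

end

namespace ECC

open scoped ENNReal
open Module Submodule

/-! Everything rests on the bond-density lemma: for a lattice triangle `T` and a lattice vector `r`,
the fractions of the bonds `(i, i + r)` lying in `T`, summed over all `i`, give the area of `T`,
provided that points on the boundary of `T` count with the weight `chi (tri T)`. Since `y` is affine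
on each triangle, `contContrib` of a bond is the sum over `T` of its fraction in `T` times `φ(|D_r
y|_T|)`. Summing over all bonds therefore yields the Cauchy–Born energy, and exchanging continuum
for exact contributions on the outer bonds gives the representation.

For the density lemma, `chi` is first replaced by the area fraction of a ball of radius `ρ`. A
parallelogram spanned by lattice vectors contains as many points of each translate of `ℤ²` as its
area says, which settles parallelograms (`bondMass_parallelogram`). Such a parallelogram consists of
`T` and its image under a point reflection that permutes the bonds of direction `r`, so `T` gets
exactly half (`bondMass_tri`). The identity holds for every `ρ`, insensitive to null sets, and
passes to the limit `ρ → 0` by dominated convergence (`hasSum_integral_chi_tri`).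

For the cost, the inner bonds are grouped by triangle and direction. Their fractions are constants
of the geometry, so each pair `(T, r)` needs one evaluation of the potential, however many bonds it
stands for. -/

/-! ### Lattice points in fundamental parallelograms -/

@[simp] theorem site_apply (i : Lattice) (k : Fin 2) : site i k = i k := rfl

theorem site_add (i j : Lattice) : site (i + j) = site i + site j := by
  ext k; simp

theorem site_sub (i j : Lattice) : site (i - j) = site i - site j := by
  ext k; simp

theorem site_neg (i : Lattice) : site (-i) = -site i := by
  ext k; simp

theorem site_zero : site 0 = 0 := by
  ext k; simp

theorem site_injective : Function.Injective site := by
  intro i j h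
  funext k
  have := congrArg (fun x : Plane => x k) h
  simpa using this

/-- The inclusion of the lattice in the plane, as a homomorphism. -/
def siteHom : Lattice →+ Plane where
  toFun := site
  map_zero' := site_zero
  map_add' := site_add

/-- A fundamental parallelogram spanned by lattice vectors contains the same number of points of
every translate of the lattice. -/
theorem exists_tsum_indicator_fundamentalDomain (b : Basis (Fin 2) ℝ Plane)
    (hb : ∀ k, ∃ i, b k = site i) :
    ∃ κ : ℝ≥0∞, ∀ z : Plane,
      ∑' i : Lattice, (ZSpan.fundamentalDomain b).indicator 1 (z + site i) = κ := by
  let L : AddSubgroup Lattice := (span ℤ (Set.range b)).toAddSubgroup.comap siteHom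
  have hL : ∀ i, i ∈ L ↔ site i ∈ span ℤ (Set.range b) := fun i => Iff.rfl
  have hrange : ∀ x ∈ span ℤ (Set.range b), ∃ i, site i = x := by
    intro x hx
    have hle : span ℤ (Set.range b) ≤ AddSubgroup.toIntSubmodule siteHom.range := by
      rw [span_le]
      rintro _ ⟨k, rfl⟩
      obtain ⟨i, hi⟩ := hb k
      exact ⟨i, hi.symm⟩
    exact hle hx
  -- The constant is the index of the sublattice spanned by `b`: its translates of the parallelogram
  -- tile the plane, so each coset has exactly one point in it.
  refine ⟨(ENat.card (Lattice ⧸ L) : ℝ≥0∞), fun z => ?_⟩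
  set S : Set Lattice := {i | z + site i ∈ ZSpan.fundamentalDomain b} with hS
  have hind : ∀ i : Lattice, (ZSpan.fundamentalDomain b).indicator (1 : Plane → ℝ≥0∞) (z + site i)
      = S.indicator 1 i := fun i => rfl
  have hbij : Function.Bijective (fun i : S => (QuotientAddGroup.mk (i : Lattice) : Lattice ⧸ L)) := by
    constructor
    · rintro ⟨i, hi⟩ ⟨j, hj⟩ hij
      have h := (hL _).1 (QuotientAddGroup.eq.1 hij)
      rw [site_add, site_neg] at h
      have h2 := (ZSpan.fract_eq_fract b (z + site i) (z + site j)).2 (by convert h using 1; abel)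
      rw [ZSpan.fract_eq_self.2 hi, ZSpan.fract_eq_self.2 hj] at h2
      exact Subtype.ext (site_injective (add_left_cancel h2))
    · intro q
      obtain ⟨i, rfl⟩ := QuotientAddGroup.mk_surjective q
      obtain ⟨l, hl⟩ := hrange _ (ZSpan.floor b (z + site i)).2
      refine ⟨⟨i - l, ?_⟩, ?_⟩
      · have := ZSpan.fract_mem_fundamentalDomain b (z + site i)
        rw [ZSpan.fract_apply, ← hl] at this
        simpa [hS, site_sub, add_sub_assoc] using this
      · rw [QuotientAddGroup.eq, hL]
        have : -(i - l) + i = l := by abel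
        rw [this, hl]
        exact (ZSpan.floor b (z + site i)).2
  simp_rw [hind]
  rw [← tsum_subtype]
  simp only [Pi.one_apply]
  rw [ENNReal.tsum_const, ENat.card_congr (Equiv.ofBijective _ hbij), mul_one]

/-- The half-open unit square. -/
def unitSquare : Set Plane :=
  ZSpan.fundamentalDomain (EuclideanSpace.basisFun (Fin 2) ℝ).toBasis

theorem mem_unitSquare {x : Plane} : x ∈ unitSquare ↔ ∀ k, x k ∈ Set.Ico (0 : ℝ) 1 := by
  simp [unitSquare, ZSpan.mem_fundamentalDomain]

theorem volume_unitSquare : volume unitSquare = 1 := by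
  have h : unitSquare = (WithLp.ofLp : Plane → Fin 2 → ℝ) ⁻¹' (Set.univ.pi fun _ => Set.Ico 0 1) := by
    ext x
    simp [mem_unitSquare]
  rw [h, (PiLp.volume_preserving_ofLp (Fin 2)).measure_preimage
    (MeasurableSet.univ_pi fun _ => measurableSet_Ico).nullMeasurableSet, Real.volume_pi_Ico]
  simp

/-- The count does not depend on `z`, and at `z = 0` only the origin lies in the half-open square.
-/
theorem tsum_indicator_unitSquare (z : Plane) :
    ∑' i : Lattice, unitSquare.indicator (1 : Plane → ℝ≥0∞) (z + site i) = 1 := by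
  obtain ⟨κ, hκ⟩ := exists_tsum_indicator_fundamentalDomain
    (EuclideanSpace.basisFun (Fin 2) ℝ).toBasis
    (fun k => ⟨Pi.single k 1, by ext j; by_cases h : j = k <;> simp [h]⟩)
  refine (hκ z).trans ?_
  rw [← hκ 0, tsum_eq_single 0]
  · have : (0 : Plane) + site 0 ∈ unitSquare := by simp [mem_unitSquare, site_zero]
    exact Set.indicator_of_mem this 1
  · intro i hi
    refine Set.indicator_of_notMem (s := unitSquare) (fun h => hi ?_) 1
    funext k
    have := mem_unitSquare.1 h k
    simp only [zero_add, site_apply, Set.mem_Ico] at this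
    have h1 : 0 ≤ i k := by exact_mod_cast this.1
    have h2 : i k < 1 := by exact_mod_cast this.2
    simp only [Pi.zero_apply]
    omega

theorem measurableSet_unitSquare : MeasurableSet unitSquare :=
  ZSpan.fundamentalDomain_measurableSet _

/-- The number of points of a translate of the lattice in a fundamental parallelogram spanned by
lattice vectors is the area of the parallelogram. -/
theorem tsum_indicator_fundamentalDomain (b : Basis (Fin 2) ℝ Plane)
    (hb : ∀ k, ∃ i, b k = site i) (z : Plane) :
    ∑' i : Lattice, (ZSpan.fundamentalDomain b).indicator 1 (z + site i)
      = volume (ZSpan.fundamentalDomain b) := by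
  obtain ⟨κ, hκ⟩ := exists_tsum_indicator_fundamentalDomain b hb
  rw [hκ]
  set F := ZSpan.fundamentalDomain b
  have hF : MeasurableSet F := ZSpan.fundamentalDomain_measurableSet b
  have hmeas : ∀ (A : Set Plane), MeasurableSet A → ∀ i : Lattice,
      Measurable fun z : Plane => A.indicator (1 : Plane → ℝ≥0∞) (z + site i) := fun A hA i =>
    (measurable_one.indicator hA).comp (measurable_id.add_const _)
  have hQ := measurableSet_unitSquare
  -- Average the constant count over the unit square, then move each translation from the
  -- parallelogram to the square; the translated squares tile the plane and the area of `F` remains.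
  calc κ = ∫⁻ z, unitSquare.indicator 1 z * κ := by
        rw [lintegral_mul_const _ (measurable_one.indicator hQ), lintegral_indicator_one hQ,
          volume_unitSquare, one_mul]
    _ = ∑' i : Lattice, ∫⁻ z, unitSquare.indicator 1 z * F.indicator 1 (z + site i) := by
        refine Eq.trans ?_ (lintegral_tsum fun i =>
          ((measurable_one.indicator hQ).mul (hmeas F hF i)).aemeasurable)
        simp_rw [ENNReal.tsum_mul_left, hκ]
    _ = ∑' i : Lattice, ∫⁻ z, unitSquare.indicator 1 (z + site (-i)) * F.indicator 1 z := by
        refine tsum_congr fun i => ?_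
        rw [← lintegral_add_right_eq_self (fun z : Plane => unitSquare.indicator (1 : Plane → ℝ≥0∞)
          (z + site (-i)) * F.indicator 1 z) (site i)]
        simp [site_neg]
    _ = ∑' i : Lattice, ∫⁻ z, unitSquare.indicator 1 (z + site i) * F.indicator 1 z :=
        (Equiv.neg Lattice).tsum_eq fun i =>
          ∫⁻ z, unitSquare.indicator (1 : Plane → ℝ≥0∞) (z + site i) * F.indicator 1 z
    _ = ∫⁻ z, F.indicator 1 z := by
        refine (lintegral_tsum fun i =>
          ((hmeas _ hQ i).mul (measurable_one.indicator hF)).aemeasurable).symm.trans ?_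
        refine lintegral_congr fun z => ?_
        refine ENNReal.tsum_mul_right.trans ?_
        rw [tsum_indicator_unitSquare, one_mul]
    _ = volume F := lintegral_indicator_one hF

/-! ### Edge coordinates of a lattice triangle -/

/-- A non-degenerate lattice triangle is the standard simplex of the coordinates with respect to
one of its vertices and the two edges that start there. -/
theorem exists_frame {T : Finset Lattice} (hT : T.card = 3)
    (hT' : AffineIndependent ℝ fun v : T => site v) :
    ∃ (a v w : Lattice) (b : Basis (Fin 2) ℝ Plane), T = {a, a + v, a + w} ∧
      b 0 = site v ∧ b 1 = site w ∧
      tri T = {x | 0 ≤ b.coord 0 (x - site a) ∧ 0 ≤ b.coord 1 (x - site a) ∧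
        b.coord 0 (x - site a) + b.coord 1 (x - site a) ≤ 1} := by
  obtain ⟨a, p, q, hap, haq, hpq, rfl⟩ := Finset.card_eq_three.1 hT
  have hli : LinearIndependent ℝ ![site (p - a), site (q - a)] := by
    rw [affineIndependent_iff_linearIndependent_vsub ℝ _ (⟨a, by simp⟩ : ({a, p, q} : Finset Lattice))]
      at hT'
    let f : Fin 2 → {x : ({a, p, q} : Finset Lattice) // x ≠ ⟨a, by simp⟩} :=
      ![⟨⟨p, by simp⟩, by simpa using hap.symm⟩, ⟨⟨q, by simp⟩, by simpa using haq.symm⟩]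
    have hf : Function.Injective f := by
      intro i j hij
      fin_cases i <;> fin_cases j <;> simp_all [f]
    have heq : ![site (p - a), site (q - a)]
        = (fun i : {x : ({a, p, q} : Finset Lattice) // x ≠ ⟨a, by simp⟩} =>
          site (i : ({a, p, q} : Finset Lattice)) -ᵥ site a) ∘ f := by
      funext k
      fin_cases k <;> simp [f, site_sub]
    rw [heq]
    exact hT'.comp f hf
  let b := basisOfLinearIndependentOfCardEqFinrank hli (by simp)
  have hb0 : b 0 = site (p - a) := by simp [b]
  have hb1 : b 1 = site (q - a) := by simp [b]
  refine ⟨a, p - a, q - a, b, by simp, hb0, hb1, ?_⟩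
  have hp : site p - site a = b 0 := by rw [hb0, site_sub]
  have hq : site q - site a = b 1 := by rw [hb1, site_sub]
  apply Set.Subset.antisymm
  · refine convexHull_min ?_ ?_
    · rintro _ ⟨x, hx, rfl⟩
      simp only [Finset.coe_insert, Finset.coe_singleton, Set.mem_insert_iff,
        Set.mem_singleton_iff] at hx
      rcases hx with rfl | rfl | rfl
      · simp
      · rw [Set.mem_ofPred_eq, hp]; simp
      · rw [Set.mem_ofPred_eq, hq]; simp
    · intro x hx y hy α β hα hβ hαβ
      have : α • x + β • y - site a = α • (x - site a) + β • (y - site a) := by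
        rw [smul_sub, smul_sub, ← sub_eq_zero]
        have : site a = (α + β) • site a := by rw [hαβ, one_smul]
        nth_rewrite 1 [this]
        module
      simp only [Set.mem_ofPred_eq, this, map_add, map_smul, smul_eq_mul] at hx hy ⊢
      obtain ⟨h1, h2, h3⟩ := hx
      obtain ⟨h4, h5, h6⟩ := hy
      refine ⟨by positivity, by positivity, ?_⟩
      nlinarith [mul_le_mul_of_nonneg_left h3 hα, mul_le_mul_of_nonneg_left h6 hβ]
  · rintro x ⟨h0, h1, h2⟩
    have hx := b.sum_repr (x - site a)
    rw [Fin.sum_univ_two, ← hp, ← hq, ← b.coord_apply, ← b.coord_apply] at hx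
    set s := b.coord 0 (x - site a)
    set t := b.coord 1 (x - site a)
    have hmem : ∀ z ∈ ({a, p, q} : Finset Lattice), site z ∈ tri {a, p, q} := fun z hz =>
      subset_convexHull ℝ _ ⟨z, hz, rfl⟩
    have := (convex_convexHull ℝ (site '' (({a, p, q} : Finset Lattice) : Set Lattice))).sum_mem
      (t := Finset.univ) (w := ![1 - s - t, s, t]) (z := ![site a, site p, site q]) ?_ ?_ ?_
    · have hx' : x = (1 - s - t) • site a + s • site p + t • site q := by
        rw [sub_eq_iff_eq_add.1 hx.symm]
        module
      rw [hx', tri]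
      simpa only [Fin.sum_univ_three, Matrix.cons_val] using this
    · intro k _
      fin_cases k
      · simp; linarith
      · simpa using h0
      · simpa using h1
    · simp only [Fin.sum_univ_three, Matrix.cons_val]
      ring
    · intro k _
      fin_cases k
      · exact hmem a (by simp)
      · exact hmem p (by simp)
      · exact hmem q (by simp)

theorem volume_setOf_linear_eq (f : Plane →ₗ[ℝ] ℝ) (hf : f ≠ 0) (c : ℝ) :
    volume {x : Plane | f x = c} = 0 := by
  rcases Set.eq_empty_or_nonempty {x : Plane | f x = c} with h | ⟨x₀, hx₀⟩
  · simp [h]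
  · have hx₀' : f x₀ = c := hx₀
    refine measure_mono_null ?_ (Measure.addHaar_affineSubspace volume
      (AffineSubspace.mk' x₀ (LinearMap.ker f)) fun h => hf ?_)
    · intro x hx
      have hx' : f x = c := hx
      simp [AffineSubspace.mem_mk', hx', hx₀']
    · have := congrArg AffineSubspace.direction h
      rw [AffineSubspace.direction_mk', AffineSubspace.direction_top] at this
      exact LinearMap.ker_eq_top.1 this

/-! ### The smoothed bond-density lemma -/

theorem measurable_volume_inter_ball {A : Set Plane} (hA : MeasurableSet A) (ρ : ℝ) :
    Measurable fun x : Plane => volume (A ∩ Metric.ball x ρ) := by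
  have hs : MeasurableSet {p : Plane × Plane | p.2 ∈ A ∧ dist p.2 p.1 < ρ} :=
    (measurable_snd hA).inter (measurableSet_lt (measurable_snd.dist measurable_fst) measurable_const)
  exact measurable_measure_prodMk_left hs

/-- The sum over the lattice of the averages over the bonds `(i, i + r)` of the area of `A` close
to a point. -/
noncomputable def bondMass (A : Set Plane) (r : Lattice) (ρ : ℝ) : ℝ≥0∞ :=
  ∑' i : Lattice, ∫⁻ t in Set.Icc (0 : ℝ) 1, volume (A ∩ Metric.ball (site i + t • site r) ρ)

theorem measurable_volume_inter_ball_bond {A : Set Plane} (hA : MeasurableSet A) (ρ : ℝ)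
    (x v : Plane) : Measurable fun t : ℝ => volume (A ∩ Metric.ball (x + t • v) ρ) :=
  (measurable_volume_inter_ball hA ρ).comp (by fun_prop)

/-- For a fixed parameter `t`, shifting all balls back to a common one turns the sum of areas into
an integral, over that ball, of the number of lattice translates of a point lying in the
parallelogram. This number is constant, so the position along the bond is irrelevant. -/
theorem bondMass_parallelogram (b : Basis (Fin 2) ℝ Plane) (hb : ∀ k, ∃ i, b k = site i)
    (a r : Lattice) (ρ : ℝ) :
    bondMass {x | x - site a ∈ ZSpan.fundamentalDomain b} r ρ
      = volume (ZSpan.fundamentalDomain b) * volume (Metric.ball (0 : Plane) ρ) := by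
  set F := ZSpan.fundamentalDomain b with hF_def
  have hF : MeasurableSet F := ZSpan.fundamentalDomain_measurableSet b
  have hP : MeasurableSet {x | x - site a ∈ F} := (measurable_id.sub_const (site a)) hF
  have key : ∀ w : Plane, ∑' i : Lattice, volume ({x | x - site a ∈ F} ∩ Metric.ball (site i + w) ρ)
      = volume F * volume (Metric.ball (0 : Plane) ρ) := by
    intro w
    have hK : MeasurableSet (Metric.ball w ρ) := measurableSet_ball
    have h1 : ∀ i : Lattice, volume ({x | x - site a ∈ F} ∩ Metric.ball (site i + w) ρ)
        = ∫⁻ z, (Metric.ball w ρ).indicator 1 z * F.indicator 1 (z - site a + site i) := by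
      intro i
      rw [← lintegral_indicator_one (hP.inter measurableSet_ball),
        ← lintegral_add_right_eq_self _ (site i)]
      refine lintegral_congr fun z => ?_
      have h2 : z + site i ∈ Metric.ball (site i + w) ρ ↔ z ∈ Metric.ball w ρ := by
        simp [Metric.mem_ball, add_comm (site i) w]
      have h3 : z + site i - site a = z - site a + site i := by abel
      by_cases h4 : z ∈ Metric.ball w ρ <;> by_cases h5 : z - site a + site i ∈ F <;>
        simp [Set.indicator, h2, h3, h4, h5]
    simp_rw [h1]
    rw [← lintegral_tsum]
    · simp_rw [ENNReal.tsum_mul_left, hF_def, tsum_indicator_fundamentalDomain b hb]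
      rw [lintegral_mul_const _ (measurable_one.indicator hK), lintegral_indicator_one hK,
        Measure.addHaar_ball_center, mul_comm]
    · intro i
      exact ((measurable_one.indicator hK).mul ((measurable_one.indicator hF).comp
        ((measurable_id.sub_const _).add_const _))).aemeasurable
  rw [bondMass, ← lintegral_tsum fun i => (measurable_volume_inter_ball_bond hP ρ _ _).aemeasurable]
  simp_rw [key]
  simp

/-- Since `c - (i + t r) = (c - r - i) + (1 - t) r`, the point reflection permutes the bonds of
direction `r`, reversing each of them. -/
theorem bondMass_reflection {A : Set Plane} (c r : Lattice) (ρ : ℝ) :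
    bondMass {x | site c - x ∈ A} r ρ = bondMass A r ρ := by
  have h1 : ∀ x : Plane, volume ({x | site c - x ∈ A} ∩ Metric.ball x ρ)
      = volume (A ∩ Metric.ball (site c - x) ρ) := by
    intro x
    have hmp := Measure.measurePreserving_sub_left (volume : Measure Plane) (site c)
    have he : MeasurableEmbedding (fun t : Plane => site c - t) :=
      (Homeomorph.subLeft (site c)).measurableEmbedding
    rw [← hmp.measure_preimage_emb he]
    congr 1
    ext z
    have hd : dist (site c - z) x = dist z (site c - x) := by
      rw [dist_eq_norm, dist_eq_norm, ← norm_neg]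
      congr 1
      abel
    simp only [Set.mem_inter_iff, Set.mem_preimage, Metric.mem_ball, Set.mem_ofPred_eq, hd,
      sub_sub_cancel]
  have h2 : ∀ g : ℝ → ℝ≥0∞, ∫⁻ t in Set.Icc (0 : ℝ) 1, g (1 - t) = ∫⁻ t in Set.Icc (0 : ℝ) 1, g t := by
    intro g
    rw [← lintegral_indicator measurableSet_Icc, ← lintegral_indicator measurableSet_Icc,
      ← lintegral_sub_left_eq_self _ (1 : ℝ)]
    refine lintegral_congr fun t => ?_
    have : (1 - t ∈ Set.Icc (0 : ℝ) 1) ↔ t ∈ Set.Icc (0 : ℝ) 1 := by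
      simp only [Set.mem_Icc]; constructor <;> rintro ⟨_, _⟩ <;> constructor <;> linarith
    by_cases h : t ∈ Set.Icc (0 : ℝ) 1
    · rw [Set.indicator_of_mem h, Set.indicator_of_mem (this.2 h)]
      simp
    · rw [Set.indicator_of_notMem h, Set.indicator_of_notMem (fun h' => h (this.1 h'))]
  simp_rw [bondMass, h1]
  rw [← (Equiv.subLeft (c - r)).tsum_eq]
  refine tsum_congr fun i => ?_
  rw [← h2]
  refine lintegral_congr fun t => ?_
  congr 3
  simp only [Equiv.subLeft_apply, site_sub]
  module

/-- Here the smoothing pays off: areas ignore a common edge of `A` and `B`, although that edge may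
contain whole bonds. -/
theorem bondMass_of_ae_eq_union {P A B : Set Plane} (hA : MeasurableSet A) (hB : MeasurableSet B)
    (h : P =ᵐ[volume] (A ∪ B : Set Plane)) (hAB : volume (A ∩ B) = 0) (r : Lattice) (ρ : ℝ) :
    bondMass P r ρ = bondMass A r ρ + bondMass B r ρ := by
  rw [bondMass, bondMass, bondMass, ← ENNReal.tsum_add]
  refine tsum_congr fun i => ?_
  rw [← lintegral_add_left (measurable_volume_inter_ball_bond hA ρ _ _)]
  refine lintegral_congr fun t => ?_
  rw [measure_congr (ae_eq_set_inter h (ae_eq_refl (Metric.ball (site i + t • site r) ρ))),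
    Set.union_inter_distrib_right]
  refine measure_union₀ (hB.inter measurableSet_ball).nullMeasurableSet ?_
  exact measure_mono_null (by grind) hAB

/-- **Bond-density lemma**, in a form smoothed at scale `ρ`. -/
theorem bondMass_tri {T : Finset Lattice} (hT : T.card = 3)
    (hT' : AffineIndependent ℝ fun v : T => site v) (r : Lattice) (ρ : ℝ) :
    bondMass (tri T) r ρ = volume (tri T) * volume (Metric.ball (0 : Plane) ρ) := by
  obtain ⟨a, v, w, b, -, hb0, hb1, htri⟩ := exists_frame hT hT'
  have hb : ∀ k, ∃ i, b k = site i := fun k => by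
    fin_cases k
    exacts [⟨v, hb0⟩, ⟨w, hb1⟩]
  set F := ZSpan.fundamentalDomain b with hF_def
  set s : Plane → ℝ := fun x => b.coord 0 (x - site a) with hs
  set t : Plane → ℝ := fun x => b.coord 1 (x - site a) with ht
  have hs_meas : Measurable s := by
    have := (b.coord 0).continuous_of_finiteDimensional
    exact (this.comp (continuous_id.sub continuous_const)).measurable
  have ht_meas : Measurable t := by
    have := (b.coord 1).continuous_of_finiteDimensional
    exact (this.comp (continuous_id.sub continuous_const)).measurable
  set P : Set Plane := {x | x - site a ∈ F} with hP
  have hPmem : ∀ x, x ∈ P ↔ (0 ≤ s x ∧ s x < 1) ∧ (0 ≤ t x ∧ t x < 1) := by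
    intro x
    simp [hP, hF_def, ZSpan.mem_fundamentalDomain, hs, ht]
  -- Twice the centre of the parallelogram: `x ↦ c - x` takes the edge coordinates `(s, t)` to `(1 -
  -- s, 1 - t)` and thus exchanges the two triangles.
  set c : Lattice := a + a + v + w with hc
  set T' : Set Plane := {x | site c - x ∈ tri T} with hT'_def
  have hTmem : ∀ x, x ∈ tri T ↔ 0 ≤ s x ∧ 0 ≤ t x ∧ s x + t x ≤ 1 := fun x => by
    rw [htri]; rfl
  have hsc : ∀ x, s (site c - x) = 1 - s x := by
    intro x
    have : site c - x - site a = b 0 + b 1 - (x - site a) := by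
      rw [hb0, hb1, hc, site_add, site_add, site_add]; abel
    change b.coord _ (site c - x - site a) = _
    rw [this, map_sub, map_add]
    simp [hs]
  have htc : ∀ x, t (site c - x) = 1 - t x := by
    intro x
    have : site c - x - site a = b 0 + b 1 - (x - site a) := by
      rw [hb0, hb1, hc, site_add, site_add, site_add]; abel
    change b.coord _ (site c - x - site a) = _
    rw [this, map_sub, map_add]
    simp [ht]
  have hT'mem : ∀ x, x ∈ T' ↔ s x ≤ 1 ∧ t x ≤ 1 ∧ 1 ≤ s x + t x := by
    intro x
    have : x ∈ T' ↔ site c - x ∈ tri T := Iff.rfl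
    rw [this, hTmem, hsc, htc]
    constructor <;> rintro ⟨_, _, _⟩ <;> refine ⟨?_, ?_, ?_⟩ <;> linarith
  have hTm : MeasurableSet (tri T) := by
    rw [htri]
    exact (measurableSet_le measurable_const hs_meas).inter
      ((measurableSet_le measurable_const ht_meas).inter
        (measurableSet_le (hs_meas.add ht_meas) measurable_const))
  have hT'm : MeasurableSet T' := (measurable_const.sub measurable_id) hTm
  have hnull : ∀ f : Plane →ₗ[ℝ] ℝ, f ≠ 0 → volume {x | f (x - site a) = 1} = 0 := by
    intro f hf
    refine measure_mono_null ?_ (volume_setOf_linear_eq f hf (1 + f (site a)))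
    intro x hx
    have : f (x - site a) = 1 := hx
    rw [map_sub] at this
    exact sub_eq_iff_eq_add.1 this
  have hn0 : volume {x | s x = 1} = 0 := hnull (b.coord 0) fun h => by
    simpa using congrArg (fun f => f (b 0)) h
  have hn1 : volume {x | t x = 1} = 0 := hnull (b.coord 1) fun h => by
    simpa using congrArg (fun f => f (b 1)) h
  have hn2 : volume {x | s x + t x = 1} = 0 := hnull (b.coord 0 + b.coord 1) fun h => by
    simpa using congrArg (fun f => f (b 0)) h
  have hinter : volume (tri T ∩ T') = 0 := by
    refine measure_mono_null ?_ hn2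
    rintro x ⟨h1, h2⟩
    exact le_antisymm ((hTmem x).1 h1).2.2 ((hT'mem x).1 h2).2.2
  have hunion : P =ᵐ[volume] (tri T ∪ T' : Set Plane) := by
    have h0 : ∀ᵐ x, ¬ s x = 1 := measure_eq_zero_iff_ae_notMem.1 hn0
    have h1 : ∀ᵐ x, ¬ t x = 1 := measure_eq_zero_iff_ae_notMem.1 hn1
    filter_upwards [h0, h1] with x h0 h1
    refine propext ?_
    change x ∈ P ↔ x ∈ tri T ∪ T'
    rw [Set.mem_union, hPmem, hTmem, hT'mem]
    constructor
    · rintro ⟨⟨_, _⟩, _, _⟩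
      rcases le_total (s x + t x) 1 with h | h
      · exact Or.inl ⟨by linarith, by linarith, h⟩
      · exact Or.inr ⟨by linarith, by linarith, h⟩
    · rintro (⟨_, _, _⟩ | ⟨_, _, _⟩)
      · exact ⟨⟨by linarith, lt_of_le_of_ne (by linarith) h0⟩, by linarith,
          lt_of_le_of_ne (by linarith) h1⟩
      · exact ⟨⟨by linarith, lt_of_le_of_ne (by linarith) h0⟩, by linarith,
          lt_of_le_of_ne (by linarith) h1⟩
  have hvolP : volume P = volume F := by
    have : P = (fun x => x + (-site a)) ⁻¹' F := by
      ext x; simp [hP, sub_eq_add_neg]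
    rw [this, measure_preimage_add_right]
  have hvolT' : volume T' = volume (tri T) :=
    (Measure.measurePreserving_sub_left (volume : Measure Plane) (site c)).measure_preimage
      hTm.nullMeasurableSet
  have hvol : volume F = 2 * volume (tri T) := by
    rw [← hvolP, measure_congr hunion, measure_union₀ hT'm.nullMeasurableSet hinter, hvolT', two_mul]
  have hmass : bondMass P r ρ = 2 * bondMass (tri T) r ρ := by
    rw [bondMass_of_ae_eq_union hTm hT'm hunion hinter, bondMass_reflection, two_mul]
  rw [bondMass_parallelogram b hb, ← hF_def, hvol, mul_assoc] at hmass
  exact ((ENNReal.mul_right_inj (by simp) (by simp)).1 hmass).symm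

/-! ### Area densities and the characteristic function -/

/-- The fraction of the ball `B_ρ(x)` that is covered by `A`. -/
noncomputable def density (A : Set Plane) (x : Plane) (ρ : ℝ) : ℝ :=
  volume.real (A ∩ Metric.ball x ρ) / volume.real (Metric.ball x ρ)

theorem density_nonneg (A : Set Plane) (x : Plane) (ρ : ℝ) : 0 ≤ density A x ρ := by
  unfold density; positivity

theorem density_le_one (A : Set Plane) (x : Plane) (ρ : ℝ) : density A x ρ ≤ 1 :=
  div_le_one_of_le₀ (measureReal_mono Set.inter_subset_right measure_ball_lt_top.ne)
    measureReal_nonneg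

theorem density_eq_zero {A : Set Plane} {x : Plane} {ρ : ℝ} (h : A ∩ Metric.ball x ρ = ∅) :
    density A x ρ = 0 := by
  simp [density, h]

theorem measurable_density {A : Set Plane} (hA : MeasurableSet A) (ρ : ℝ) :
    Measurable fun x => density A x ρ := by
  have h : ∀ {A : Set Plane}, MeasurableSet A →
      Measurable fun x : Plane => volume.real (A ∩ Metric.ball x ρ) := fun hA =>
    (measurable_volume_inter_ball hA ρ).ennreal_toReal
  have h2 := h (A := Set.univ) MeasurableSet.univ
  simp only [Set.univ_inter] at h2
  exact (h hA).div h2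

theorem chi_eq_of_tendsto {A : Set Plane} {x : Plane} {c : ℝ}
    (h : Tendsto (density A x) (𝓝[>] 0) (𝓝 c)) : chi A x = c :=
  h.limUnder_eq

theorem tendsto_density_of_mem_nhds {A : Set Plane} {x : Plane} (h : A ∈ 𝓝 x) :
    Tendsto (density A x) (𝓝[>] 0) (𝓝 1) := by
  obtain ⟨ε, hε, hA⟩ := Metric.mem_nhds_iff.1 h
  refine tendsto_const_nhds.congr' ?_
  filter_upwards [Ioo_mem_nhdsGT hε] with ρ hρ
  have hsub : Metric.ball x ρ ⊆ A := (Metric.ball_subset_ball hρ.2.le).trans hA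
  rw [density, Set.inter_eq_right.2 hsub, div_self]
  exact (ENNReal.toReal_pos (Metric.measure_ball_pos volume x hρ.1).ne'
    measure_ball_lt_top.ne).ne'

theorem tendsto_density_of_notMem_closure {A : Set Plane} {x : Plane} (h : x ∉ closure A) :
    Tendsto (density A x) (𝓝[>] 0) (𝓝 0) := by
  obtain ⟨ε, hε, hA⟩ := Metric.mem_nhds_iff.1 (isClosed_closure.isOpen_compl.mem_nhds h)
  refine tendsto_const_nhds.congr' ?_
  filter_upwards [Ioo_mem_nhdsGT hε] with ρ hρ
  refine (density_eq_zero ?_).symm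
  ext z
  simp only [Set.mem_inter_iff, Set.mem_empty_iff_false, iff_false, not_and]
  intro hz hz'
  exact hA (Metric.ball_subset_ball hρ.2.le hz') (subset_closure hz)

theorem chi_eq_one {A : Set Plane} {x : Plane} (h : A ∈ 𝓝 x) : chi A x = 1 :=
  chi_eq_of_tendsto (tendsto_density_of_mem_nhds h)

theorem chi_eq_zero {A : Set Plane} {x : Plane} (h : x ∉ closure A) : chi A x = 0 :=
  chi_eq_of_tendsto (tendsto_density_of_notMem_closure h)

/-- Seen from one of its points, a convex set fills a fraction of the balls that increases as the
radius decreases. -/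
theorem antitoneOn_density_of_convex {A : Set Plane} (hA : Convex ℝ A) {x : Plane} (hx : x ∈ A) :
    AntitoneOn (density A x) (Set.Ioi 0) := by
  intro ρ hρ σ hσ hρσ
  have hρ' : (0 : ℝ) < ρ := hρ
  have hσ' : (0 : ℝ) < σ := hσ
  have hq0 : 0 < ρ / σ := by positivity
  have hq1 : ρ / σ ≤ 1 := (div_le_one hσ').2 hρσ
  -- Shrinking towards a point of a convex set stays in the set, and areas scale by the same factor
  -- as those of the balls.
  have hsub : AffineMap.homothety x (ρ / σ) '' (A ∩ Metric.ball x σ) ⊆ A ∩ Metric.ball x ρ := by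
    rintro _ ⟨z, ⟨hz, hz'⟩, rfl⟩
    have he : AffineMap.homothety x (ρ / σ) z = (ρ / σ) • (z - x) + x := by
      simp [AffineMap.homothety_apply]
    refine ⟨?_, ?_⟩
    · have := hA hx hz (sub_nonneg.2 hq1) hq0.le (by ring)
      convert this using 1
      rw [he]; module
    · rw [he, Metric.mem_ball, dist_eq_norm, add_sub_cancel_right, norm_smul, Real.norm_of_nonneg hq0.le]
      rw [Metric.mem_ball, dist_eq_norm] at hz'
      calc ρ / σ * ‖z - x‖ < ρ / σ * σ := by gcongr
        _ = ρ := by field_simp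
  have hvol := measureReal_mono (μ := (volume : Measure Plane)) hsub
    (measure_ne_top_of_subset Set.inter_subset_right measure_ball_lt_top.ne)
  have hfin : finrank ℝ Plane = 2 := by simp
  rw [measureReal_def, Measure.addHaar_image_homothety, hfin, ENNReal.toReal_mul,
    ENNReal.toReal_ofReal (abs_nonneg _), abs_of_nonneg (by positivity)] at hvol
  have hball : ∀ τ : ℝ, 0 < τ →
      volume.real (Metric.ball x τ) = τ ^ 2 * volume.real (Metric.ball (0 : Plane) 1) := by
    intro τ hτ
    rw [measureReal_def, Measure.addHaar_ball _ _ hτ.le, hfin, ENNReal.toReal_mul,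
      ENNReal.toReal_ofReal (by positivity), measureReal_def]
  have hunit : 0 < volume.real (Metric.ball (0 : Plane) 1) :=
    ENNReal.toReal_pos (Metric.measure_ball_pos volume _ one_pos).ne' measure_ball_lt_top.ne
  rw [density, density, hball ρ hρ', hball σ hσ', div_le_div_iff₀ (by positivity) (by positivity)]
  change (ρ / σ) ^ 2 * volume.real (A ∩ Metric.ball x σ) ≤ _ at hvol
  rw [div_pow, div_mul_eq_mul_div, div_le_iff₀ (by positivity)] at hvol
  nlinarith [mul_le_mul_of_nonneg_right hvol hunit.le]

/-- At points of the set the density is monotone in the radius and bounded; elsewhere it vanishes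
for small radii. So the limit exists at every point, without which `limUnder` in `chi` would carry
no information. -/
theorem tendsto_density_of_convex {A : Set Plane} (hA : Convex ℝ A) (hA' : IsClosed A) (x : Plane) :
    Tendsto (density A x) (𝓝[>] 0) (𝓝 (chi A x)) := by
  by_cases hx : x ∈ A
  · have h := (antitoneOn_density_of_convex hA hx).tendsto_nhdsGT
      ⟨1, by rintro _ ⟨ρ, -, rfl⟩; exact density_le_one A x ρ⟩
    rwa [chi_eq_of_tendsto h]
  · have h := tendsto_density_of_notMem_closure (A := A) (x := x) (by rwa [hA'.closure_eq])
    rwa [chi_eq_of_tendsto h]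

theorem isCompact_tri (T : Finset Lattice) : IsCompact (tri T) :=
  (T.finite_toSet.image site).isCompact_convexHull ℝ

theorem convex_tri (T : Finset Lattice) : Convex ℝ (tri T) := convex_convexHull ℝ _

theorem isClosed_tri (T : Finset Lattice) : IsClosed (tri T) := (isCompact_tri T).isClosed

theorem tendsto_density_tri (T : Finset Lattice) (x : Plane) :
    Tendsto (density (tri T) x) (𝓝[>] 0) (𝓝 (chi (tri T) x)) :=
  tendsto_density_of_convex (convex_tri T) (isClosed_tri T) x

theorem chi_tri_nonneg (T : Finset Lattice) (x : Plane) : 0 ≤ chi (tri T) x :=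
  ge_of_tendsto' (tendsto_density_tri T x) fun _ => density_nonneg _ _ _

theorem chi_tri_le_one (T : Finset Lattice) (x : Plane) : chi (tri T) x ≤ 1 :=
  le_of_tendsto' (tendsto_density_tri T x) fun _ => density_le_one _ _ _

theorem chi_tri_eq_zero {T : Finset Lattice} {x : Plane} (h : x ∉ tri T) : chi (tri T) x = 0 :=
  chi_eq_zero (by rwa [(isClosed_tri T).closure_eq])

theorem measurable_chi_tri (T : Finset Lattice) : Measurable (chi (tri T)) :=
  measurable_of_tendsto_metrizable' (𝓝[>] (0 : ℝ))
    (fun ρ => measurable_density (isClosed_tri T).measurableSet ρ)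
    (tendsto_pi_nhds.2 fun x => tendsto_density_tri T x)

theorem intervalIntegrable_chi_tri (T : Finset Lattice) (x v : Plane) :
    IntervalIntegrable (fun t : ℝ => chi (tri T) (x + t • v)) volume 0 1 := by
  refine (intervalIntegrable_const (c := (1 : ℝ))).mono_fun
    ((measurable_chi_tri T).comp (by fun_prop)).aestronglyMeasurable (ae_of_all _ fun t => ?_)
  simp only [Real.norm_of_nonneg (chi_tri_nonneg _ _), norm_one]
  exact chi_tri_le_one _ _

/-! ### The limit of vanishing smoothing radius -/

theorem finite_setOf_norm_site_le (C : ℝ) : {i : Lattice | ‖site i‖ ≤ C}.Finite := by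
  refine ((bonds_finite (Metric.isBounded_closedBall (x := (0 : Plane)) (r := C)) {0}).image
    Prod.fst).subset fun i hi => ⟨(i, 0), ?_, rfl⟩
  have : ‖site i‖ ≤ C := hi
  simp [bonds, this]

/-- This is `bondMass_tri` divided by the area of the ball, as a finite real sum in which limits can
be taken termwise. -/
theorem sum_integral_density_tri {T : Finset Lattice} (hT : T.card = 3)
    (hT' : AffineIndependent ℝ fun v : T => site v) (r : Lattice) {ρ : ℝ} (hρ : 0 < ρ)
    {I : Finset Lattice}
    (hI : ∀ i ∉ I, ∀ t ∈ Set.Icc (0 : ℝ) 1, tri T ∩ Metric.ball (site i + t • site r) ρ = ∅) :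
    ∑ i ∈ I, ∫ t in (0 : ℝ)..1, density (tri T) (site i + t • site r) ρ = volume.real (tri T) := by
  have hm := (isClosed_tri T).measurableSet
  have hB : (volume (Metric.ball (0 : Plane) ρ)) ≠ ⊤ := measure_ball_lt_top.ne
  have hB0 : volume.real (Metric.ball (0 : Plane) ρ) ≠ 0 :=
    (ENNReal.toReal_pos (Metric.measure_ball_pos volume _ hρ).ne' hB).ne'
  have hint : ∀ i : Lattice, ∫ t in (0 : ℝ)..1, density (tri T) (site i + t • site r) ρ
      = (∫⁻ t in Set.Icc (0 : ℝ) 1, volume (tri T ∩ Metric.ball (site i + t • site r) ρ)).toReal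
        / volume.real (Metric.ball (0 : Plane) ρ) := by
    intro i
    have h1 : ∀ x : Plane, density (tri T) x ρ
        = (volume (tri T ∩ Metric.ball x ρ)).toReal / volume.real (Metric.ball (0 : Plane) ρ) := by
      intro x
      rw [density, measureReal_def, measureReal_def, measureReal_def, Measure.addHaar_ball_center]
    simp_rw [h1]
    rw [intervalIntegral.integral_div, intervalIntegral.integral_of_le zero_le_one,
      ← integral_Icc_eq_integral_Ioc, integral_toReal]
    · exact (measurable_volume_inter_ball_bond hm ρ _ _).aemeasurable
    · exact ae_of_all _ fun t => (measure_mono Set.inter_subset_right).trans_lt measure_ball_lt_top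
  have hmass := bondMass_tri hT hT' r ρ
  rw [bondMass, tsum_eq_sum (s := I)] at hmass
  · have h2 := congrArg ENNReal.toReal hmass
    rw [ENNReal.toReal_sum, ENNReal.toReal_mul] at h2
    · simp_rw [hint]
      rw [← Finset.sum_div, h2]
      exact mul_div_cancel_right₀ _ hB0
    · intro i hi
      refine ne_top_of_le_ne_top (b := volume (tri T) * volume (Metric.ball (0 : Plane) ρ))
        (ENNReal.mul_ne_top (isCompact_tri T).measure_lt_top.ne hB) ?_
      rw [← hmass]
      exact Finset.single_le_sum (f := fun i => ∫⁻ t in Set.Icc (0 : ℝ) 1,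
        volume (tri T ∩ Metric.ball (site i + t • site r) ρ)) (fun _ _ => zero_le) hi
  · intro i hi
    rw [setLIntegral_congr_fun (g := fun _ => 0) measurableSet_Icc]
    · simp
    · intro t ht
      simp [hI i hi t ht]

/-- **Bond-density lemma**: the total length of the bonds of direction `r` in a lattice triangle,
in units of the length of `r`, is the area of the triangle. -/
theorem hasSum_integral_chi_tri {T : Finset Lattice} (hT : T.card = 3)
    (hT' : AffineIndependent ℝ fun v : T => site v) (r : Lattice) :
    HasSum (fun i : Lattice => ∫ t in (0 : ℝ)..1, chi (tri T) (site i + t • site r))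
      (volume.real (tri T)) := by
  obtain ⟨C, hC⟩ := (isCompact_tri T).isBounded.exists_norm_le
  -- If a bond comes within distance `1` of the triangle, its starting point has norm at most `C + 1
  -- + ‖r‖`. One finite set thus serves all radii below `1`.
  let I : Finset Lattice := (finite_setOf_norm_site_le (C + 1 + ‖site r‖)).toFinset
  have hI : ∀ i ∉ I, ∀ t ∈ Set.Icc (0 : ℝ) 1, tri T ∩ Metric.ball (site i + t • site r) 1 = ∅ := by
    intro i hi t ht
    by_contra hne
    obtain ⟨z, hz, hz'⟩ := Set.nonempty_iff_ne_empty.2 hne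
    refine hi ?_
    simp only [I, Set.Finite.mem_toFinset, Set.mem_ofPred_eq]
    have h1 := hC z hz
    rw [Metric.mem_ball, dist_eq_norm, norm_sub_rev] at hz'
    have h2 : ‖t • site r‖ ≤ ‖site r‖ := by
      rw [norm_smul, Real.norm_of_nonneg ht.1]
      exact mul_le_of_le_one_left (norm_nonneg _) ht.2
    calc ‖site i‖ = ‖(site i + t • site r - z) + z - t • site r‖ := by congr 1; abel
      _ ≤ ‖site i + t • site r - z‖ + ‖z‖ + ‖t • site r‖ :=
          (norm_sub_le _ _).trans (by gcongr; exact norm_add_le _ _)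
      _ ≤ C + 1 + ‖site r‖ := by linarith
  have hzero : ∀ i ∉ I, ∫ t in (0 : ℝ)..1, chi (tri T) (site i + t • site r) = 0 := by
    intro i hi
    rw [intervalIntegral.integral_congr (g := fun _ => 0)]
    · simp
    · intro t ht
      rw [Set.uIcc_of_le zero_le_one] at ht
      refine chi_tri_eq_zero fun h => ?_
      have : site i + t • site r ∈ tri T ∩ Metric.ball (site i + t • site r) 1 :=
        ⟨h, Metric.mem_ball_self one_pos⟩
      rw [hI i hi t ht] at this
      exact this
  -- Densities are bounded by `1`, so the integrals converge termwise; by `hconst` the same sums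
  -- equal the area of the triangle for all small radii.
  have hlim : Tendsto (fun ρ => ∑ i ∈ I, ∫ t in (0 : ℝ)..1, density (tri T) (site i + t • site r) ρ)
      (𝓝[>] 0) (𝓝 (∑ i ∈ I, ∫ t in (0 : ℝ)..1, chi (tri T) (site i + t • site r))) := by
    refine tendsto_finsetSum _ fun i _ => ?_
    refine intervalIntegral.tendsto_integral_filter_of_dominated_convergence (fun _ => 1)
      (Eventually.of_forall fun ρ => ?_) (Eventually.of_forall fun ρ => ae_of_all _ fun t _ => ?_)
      intervalIntegrable_const (ae_of_all _ fun t _ => tendsto_density_tri T _)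
    · exact ((measurable_density (isClosed_tri T).measurableSet ρ).comp
        (by fun_prop)).aestronglyMeasurable
    · rw [Real.norm_of_nonneg (density_nonneg _ _ _)]
      exact density_le_one _ _ _
  have hconst : Tendsto (fun ρ => ∑ i ∈ I, ∫ t in (0 : ℝ)..1,
      density (tri T) (site i + t • site r) ρ) (𝓝[>] 0) (𝓝 (volume.real (tri T))) := by
    refine tendsto_const_nhds.congr' ?_
    filter_upwards [Ioo_mem_nhdsGT (zero_lt_one' ℝ)] with ρ hρ
    refine (sum_integral_density_tri hT hT' r hρ.1 fun i hi t ht => ?_).symm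
    exact Set.subset_empty_iff.1 ((Set.inter_subset_inter_right _
      (Metric.ball_subset_ball hρ.2.le)).trans (hI i hi t ht).subset)
  rw [← tendsto_nhds_unique hlim hconst]
  exact hasSum_sum_of_ne_finset_zero hzero

/-! ### Additivity over a triangulation -/

theorem ae_eq_interior_tri (T : Finset Lattice) : interior (tri T) =ᵐ[volume] tri T :=
  interior_ae_eq_of_null_frontier (Convex.addHaar_frontier volume (convex_tri T))

namespace IsTriangulation

variable {𝒯 : Finset (Finset Lattice)} {ω : Set Plane}

theorem isOpen (h : IsTriangulation 𝒯 ω) : IsOpen ω := h.region_eq ▸ isOpen_interior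

theorem interior_tri_subset (h : IsTriangulation 𝒯 ω) {T : Finset Lattice} (hT : T ∈ 𝒯) :
    interior (tri T) ⊆ ω := by
  rw [h.region_eq]
  exact interior_mono (Set.subset_biUnion_of_mem (u := fun T => tri T) hT)

/-- A point of the union outside `ω` lies on the boundary of some triangle, and boundaries of convex
sets are null. -/
theorem ae_eq_iUnion (h : IsTriangulation 𝒯 ω) :
    ω =ᵐ[volume] (⋃ T ∈ 𝒯, tri T : Set Plane) := by
  refine (h.region_eq ▸ interior_subset : ω ⊆ ⋃ T ∈ 𝒯, tri T).eventuallyLE.antisymm ?_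
  have hnull : ∀ᵐ x, ∀ T ∈ 𝒯, x ∉ tri T \ interior (tri T) := by
    refine (ae_ball_iff 𝒯.countable_toSet).2 ?_
    intro T _
    exact measure_eq_zero_iff_ae_notMem.1 (ae_le_set.1 (ae_eq_interior_tri T).symm.le)
  filter_upwards [hnull] with x hx hx'
  obtain ⟨T, hT, hxT⟩ := Set.mem_iUnion₂.1 hx'
  exact h.interior_tri_subset hT (by_contra fun hc => hx T hT ⟨hxT, hc⟩)

theorem aedisjoint (h : IsTriangulation 𝒯 ω) :
    (𝒯 : Set (Finset Lattice)).Pairwise (Function.onFun (AEDisjoint volume) tri) := by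
  intro T hT T' hT' hne
  refine AEDisjoint.congr (h.nonoverlapping T hT T' hT' hne).aedisjoint ?_ ?_
  · exact (ae_eq_interior_tri T).symm
  · exact (ae_eq_interior_tri T').symm

theorem density_eq_sum (h : IsTriangulation 𝒯 ω) (x : Plane) (ρ : ℝ) :
    density ω x ρ = ∑ T ∈ 𝒯, density (tri T) x ρ := by
  simp_rw [density]
  rw [← Finset.sum_div]
  congr 1
  rw [measureReal_congr (ae_eq_set_inter h.ae_eq_iUnion (ae_eq_refl (Metric.ball x ρ))),
    Set.iUnion₂_inter, measureReal_def, measure_biUnion_finset₀, ENNReal.toReal_sum]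
  · rfl
  · exact fun T _ => measure_ne_top_of_subset Set.inter_subset_right measure_ball_lt_top.ne
  · intro T hT T' hT' hne
    exact (h.aedisjoint hT hT' hne).mono Set.inter_subset_left Set.inter_subset_left
  · exact fun T _ => ((isClosed_tri T).measurableSet.inter measurableSet_ball).nullMeasurableSet

/-- Densities add up exactly at each radius, so this holds at every point, edges and vertices
included, and the limit for `ω` exists because those for the triangles do. -/
theorem chi_eq_sum (h : IsTriangulation 𝒯 ω) (x : Plane) :
    chi ω x = ∑ T ∈ 𝒯, chi (tri T) x := by
  refine chi_eq_of_tendsto ?_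
  rw [funext (h.density_eq_sum x)]
  exact tendsto_finsetSum _ fun T _ => tendsto_density_tri T x

theorem chi_tri_eq_zero_of_notMem_closure (h : IsTriangulation 𝒯 ω) {T : Finset Lattice}
    (hT : T ∈ 𝒯) {x : Plane} (hx : x ∉ closure ω) : chi (tri T) x = 0 := by
  have h1 := h.chi_eq_sum x
  rw [chi_eq_zero hx] at h1
  exact (Finset.sum_eq_zero_iff_of_nonneg fun T _ => chi_tri_nonneg T x).1 h1.symm T hT

end IsTriangulation

/-! ### Piecewise affine deformations along bonds -/

theorem bondPoint_eq (b : Lattice × Lattice) (t : ℝ) :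
    bondPoint b t = site b.1 + t • site b.2 := by
  rw [bondPoint, site_add]
  module

theorem bondPoint_mem_seg (b : Lattice × Lattice) {t : ℝ} (ht : t ∈ Set.Ioo (0 : ℝ) 1) :
    bondPoint b t ∈ seg b :=
  ⟨1 - t, t, by linarith [ht.2], ht.1, by ring, rfl⟩

/-- Only the line through `x` in direction `r` matters, so `x` may lie on an edge of `S` parallel to
`r`. -/
theorem dirDeriv_eq_linear {y : Plane → Plane} {A : Plane →ᵃ[ℝ] Plane} {S : Set Plane}
    (hA : Set.EqOn y A S) {r : Lattice} {x : Plane} (hx : ∀ᶠ s : ℝ in 𝓝 0, x + s • site r ∈ S) :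
    dirDeriv r y x = A.linear (site r) := by
  have h : (fun s : ℝ => y (x + s • site r)) =ᶠ[𝓝 0] fun s => A x + s • A.linear (site r) := by
    filter_upwards [hx] with s hs
    rw [hA hs, add_comm x, ← vadd_eq_add, A.map_vadd, map_smul, vadd_eq_add, add_comm]
  rw [dirDeriv, lineDeriv, h.deriv_eq]
  have := ((hasDerivAt_id (0 : ℝ)).smul_const (A.linear (site r))).const_add (A x)
  simpa using this.deriv

theorem dirDeriv_eq_linear_of_mem_interior {y : Plane → Plane} {A : Plane →ᵃ[ℝ] Plane}
    {S : Set Plane} (hA : Set.EqOn y A S) {r : Lattice} {x : Plane} (hx : x ∈ interior S) :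
    dirDeriv r y x = A.linear (site r) := by
  refine dirDeriv_eq_linear hA ?_
  have h : Tendsto (fun s : ℝ => x + s • site r) (𝓝 0) (𝓝 x) := by
    have : Continuous fun s : ℝ => x + s • site r := by fun_prop
    simpa using this.tendsto 0
  exact h (mem_interior_iff_mem_nhds.1 hx)

/-- Almost every point of a line that lies in a convex set is not an endpoint of the intersection. -/
theorem ae_eventually_mem_of_convex {S : Set Plane} (hS : Convex ℝ S) (x v : Plane) :
    ∀ᵐ t : ℝ, x + t • v ∈ S → ∀ᶠ s : ℝ in 𝓝 0, x + t • v + s • v ∈ S := by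
  let S' : Set ℝ := {t | x + t • v ∈ S}
  have hS' : Convex ℝ S' := by
    intro s hs t ht α β hα hβ hαβ
    have := hS hs ht hα hβ hαβ
    change x + (α • s + β • t) • v ∈ S
    convert this using 1
    rw [smul_add, smul_add, smul_smul, smul_smul, add_add_add_comm, ← add_smul, ← add_smul, hαβ,
      one_smul]
    rfl
  filter_upwards [measure_eq_zero_iff_ae_notMem.1 (Convex.addHaar_frontier volume hS')]
    with t ht hmem
  have hint : S' ∈ 𝓝 t := by
    rw [← mem_interior_iff_mem_nhds]
    by_contra h
    exact ht ⟨subset_closure hmem, h⟩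
  have h0 : Tendsto (fun s : ℝ => t + s) (𝓝 0) (𝓝 t) := by
    simpa using (continuous_const_add t).tendsto 0
  filter_upwards [h0 hint] with s hs
  have hs' : x + (t + s) • v ∈ S := hs
  rwa [add_smul, ← add_assoc] at hs'

/-- The fraction of the bond `b` that lies in the triangle `T`, edges of `T` counting half. -/
noncomputable def bondFraction (T : Finset Lattice) (b : Lattice × Lattice) : ℝ :=
  ∫ t in (0 : ℝ)..1, chi (tri T) (site b.1 + t • site b.2)

namespace IsTriangulation

variable {𝒯 : Finset (Finset Lattice)} {ω : Set Plane}

/-- For almost every `t` the line stays, near the point, in each triangle containing it, so `D_r y`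
equals the constant of each of them. On a bond along a common edge the constants of both triangles
therefore agree. Where no triangle is met, all weights vanish. -/
theorem contDensity_ae_eq (h : IsTriangulation 𝒯 ω) {y : Plane → Plane}
    {A : Finset Lattice → Plane →ᵃ[ℝ] Plane} (hA : ∀ T ∈ 𝒯, Set.EqOn y (A T) (tri T))
    (φ : ℝ → ℝ) (b : Lattice × Lattice) :
    (fun t => contDensity ω φ y b (bondPoint b t)) =ᵐ[volume] fun t => ∑ T ∈ 𝒯,
      chi (tri T) (site b.1 + t • site b.2) * φ ‖(A T).linear (site b.2)‖ := by
  have hae : ∀ᵐ t : ℝ, ∀ T ∈ 𝒯, site b.1 + t • site b.2 ∈ tri T →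
      ∀ᶠ s : ℝ in 𝓝 0, site b.1 + t • site b.2 + s • site b.2 ∈ tri T :=
    (ae_ball_iff 𝒯.countable_toSet).2 fun T _ => ae_eventually_mem_of_convex (convex_tri T) _ _
  filter_upwards [hae] with t ht
  rw [contDensity, bondPoint_eq, h.chi_eq_sum, Finset.sum_mul]
  refine Finset.sum_congr rfl fun T hT => ?_
  by_cases hx : site b.1 + t • site b.2 ∈ tri T
  · rw [dirDeriv_eq_linear (hA T hT) (ht T hT hx)]
  · rw [chi_tri_eq_zero hx, zero_mul, zero_mul]

theorem intervalIntegrable_contDensity (h : IsTriangulation 𝒯 ω) {y : Plane → Plane}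
    {A : Finset Lattice → Plane →ᵃ[ℝ] Plane} (hA : ∀ T ∈ 𝒯, Set.EqOn y (A T) (tri T))
    (φ : ℝ → ℝ) (b : Lattice × Lattice) :
    IntervalIntegrable (fun t => contDensity ω φ y b (bondPoint b t)) volume 0 1 := by
  refine IntervalIntegrable.congr_ae ?_ (ae_restrict_of_ae (h.contDensity_ae_eq hA φ b).symm)
  have := IntervalIntegrable.sum (μ := volume) (a := 0) (b := 1) 𝒯
    (f := fun T t => chi (tri T) (site b.1 + t • site b.2) * φ ‖(A T).linear (site b.2)‖)
    fun T _ => (intervalIntegrable_chi_tri T _ _).mul_const _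
  simpa only [Finset.sum_fn] using this

theorem contContrib_eq_sum (h : IsTriangulation 𝒯 ω) {y : Plane → Plane}
    {A : Finset Lattice → Plane →ᵃ[ℝ] Plane} (hA : ∀ T ∈ 𝒯, Set.EqOn y (A T) (tri T))
    (φ : ℝ → ℝ) (b : Lattice × Lattice) :
    contContrib ω φ y b = ∑ T ∈ 𝒯, bondFraction T b * φ ‖(A T).linear (site b.2)‖ := by
  rw [contContrib, bondAverage, intervalIntegral.integral_congr_ae
    ((h.contDensity_ae_eq hA φ b).mono fun t ht _ => ht), intervalIntegral.integral_finsetSum]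
  · simp_rw [intervalIntegral.integral_mul_const]
    rfl
  · exact fun T _ => (intervalIntegrable_chi_tri T _ _).mul_const _

theorem bondFraction_eq_zero (h : IsTriangulation 𝒯 ω) {T : Finset Lattice} (hT : T ∈ 𝒯)
    {b : Lattice × Lattice} (hb : seg b ∩ closure ω = ∅) : bondFraction T b = 0 := by
  -- The endpoints do not belong to `seg b` and may lie in `closure ω`; they are removed as a null
  -- set.
  rw [bondFraction, intervalIntegral.integral_of_le zero_le_one, integral_Ioc_eq_integral_Ioo]
  refine setIntegral_eq_zero_of_forall_eq_zero fun t ht => ?_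
  refine h.chi_tri_eq_zero_of_notMem_closure hT fun hx => ?_
  have : bondPoint b t ∈ seg b ∩ closure ω :=
    ⟨bondPoint_mem_seg b ht, by rwa [bondPoint_eq]⟩
  rw [hb] at this
  exact this

/-- The bonds of direction `r` cover a triangle with unit density. -/
theorem sum_bondFraction (h : IsTriangulation 𝒯 ω) {T : Finset Lattice} (hT : T ∈ 𝒯)
    {r : Lattice} {B : Finset (Lattice × Lattice)}
    (hB : ∀ i : Lattice, (seg (i, r) ∩ closure ω).Nonempty → (i, r) ∈ B) :
    ∑ b ∈ B with b.2 = r, bondFraction T b = volume.real (tri T) := by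
  classical
  have h1 := hasSum_integral_chi_tri (h.card_eq T hT) (h.nondegenerate T hT) r
  -- Bonds missing from `B` do not meet `closure ω`, so the finite sum is the sum over the whole
  -- lattice.
  have h2 : HasSum (fun i : Lattice => bondFraction T (i, r))
      (∑ i ∈ (B.filter fun b => b.2 = r).image Prod.fst, bondFraction T (i, r)) := by
    refine hasSum_sum_of_ne_finset_zero fun i hi => h.bondFraction_eq_zero hT ?_
    by_contra hne
    exact hi (Finset.mem_image.2
      ⟨(i, r), by simp [hB i (Set.nonempty_iff_ne_empty.2 hne)], rfl⟩)
  rw [h1.unique h2, Finset.sum_image]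
  · refine Finset.sum_congr rfl fun b hb => ?_
    rw [← (Finset.mem_filter.1 hb).2]
  · intro b hb b' hb' hbb
    have h3 := (Finset.mem_filter.1 hb).2
    have h4 := (Finset.mem_filter.1 hb').2
    exact Prod.ext hbb (h3.trans h4.symm)

theorem sum_bondFraction_mul {R : Finset Lattice} {B : Finset (Lattice × Lattice)}
    (hBR : ∀ b ∈ B, b.2 ∈ R) (T : Finset Lattice) (g : Lattice → ℝ) :
    ∑ b ∈ B, bondFraction T b * g b.2
      = ∑ r ∈ R, (∑ b ∈ B with b.2 = r, bondFraction T b) * g r := by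
  rw [← Finset.sum_fiberwise_of_maps_to hBR]
  refine Finset.sum_congr rfl fun r _ => ?_
  rw [Finset.sum_mul]
  refine Finset.sum_congr rfl fun b hb => ?_
  rw [(Finset.mem_filter.1 hb).2]

/-- The set `B` is left general because two choices are needed: for all bonds the inner sums become
areas, for the inner bonds they are the constant weights of the computation. -/
theorem sum_contContrib (h : IsTriangulation 𝒯 ω) {y : Plane → Plane}
    {A : Finset Lattice → Plane →ᵃ[ℝ] Plane} (hA : ∀ T ∈ 𝒯, Set.EqOn y (A T) (tri T))
    (φ : ℝ → ℝ) {R : Finset Lattice} {B : Finset (Lattice × Lattice)} (hBR : ∀ b ∈ B, b.2 ∈ R) :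
    ∑ b ∈ B, contContrib ω φ y b = ∑ T ∈ 𝒯, ∑ r ∈ R,
      (∑ b ∈ B with b.2 = r, bondFraction T b) * φ ‖(A T).linear (site r)‖ := by
  simp_rw [h.contContrib_eq_sum hA]
  rw [Finset.sum_comm]
  exact Finset.sum_congr rfl fun T _ =>
    sum_bondFraction_mul hBR T fun r => φ ‖(A T).linear (site r)‖

end IsTriangulation

/-! ### The Cauchy–Born energy -/

/-- Both edge coordinates of the barycenter are `1/3`. Being interior, it is a point at which `D_r
y` takes its constant value on the triangle. -/
theorem barycenter_mem_interior {T : Finset Lattice} (hT : T.card = 3)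
    (hT' : AffineIndependent ℝ fun v : T => site v) : barycenter T ∈ interior (tri T) := by
  obtain ⟨a, v, w, b, rfl, hb0, hb1, htri⟩ := exists_frame hT hT'
  have hc : ∀ k, Continuous fun x => b.coord k (x - site a) := fun k =>
    (b.coord k).continuous_of_finiteDimensional.comp (continuous_id.sub continuous_const)
  have hopen : IsOpen {x | 0 < b.coord 0 (x - site a) ∧ 0 < b.coord 1 (x - site a) ∧
      b.coord 0 (x - site a) + b.coord 1 (x - site a) < 1} :=
    (isOpen_lt continuous_const (hc 0)).inter ((isOpen_lt continuous_const (hc 1)).inter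
      (isOpen_lt ((hc 0).add (hc 1)) continuous_const))
  refine interior_maximal (s := tri {a, a + v, a + w}) ?_ hopen ?_
  · rw [htri]
    exact fun x hx => ⟨hx.1.le, hx.2.1.le, hx.2.2.le⟩
  · have hv : v ≠ 0 := by
      rintro rfl
      exact b.ne_zero 0 (hb0.trans site_zero)
    have hw : w ≠ 0 := by
      rintro rfl
      exact b.ne_zero 1 (hb1.trans site_zero)
    have hvw : v ≠ w := by
      rintro rfl
      exact zero_ne_one (b.injective (hb0.trans hb1.symm))
    have hbar : barycenter {a, a + v, a + w} - site a = (3 : ℝ)⁻¹ • (b 0 + b 1) := by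
      rw [barycenter, Finset.sum_insert (by simp [hv, hw]),
        Finset.sum_pair (by simpa using hvw), site_add, site_add, hb0, hb1]
      module
    simp only [Set.mem_ofPred_eq, hbar]
    simp
    norm_num

theorem cauchyBornDensity_eq {y : Plane → Plane} {A : Plane →ᵃ[ℝ] Plane} {S : Set Plane}
    (hA : Set.EqOn y A S) (φ : ℝ → ℝ) (R : Finset Lattice) {x : Plane} (hx : x ∈ interior S) :
    cauchyBornDensity R φ y x = ∑ r ∈ R, φ ‖A.linear (site r)‖ :=
  Finset.sum_congr rfl fun r _ => by rw [dirDeriv_eq_linear_of_mem_interior hA hx]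

theorem integrableOn_interior_cauchyBornDensity {y : Plane → Plane} {A : Plane →ᵃ[ℝ] Plane}
    {T : Finset Lattice} (hA : Set.EqOn y A (tri T)) (φ : ℝ → ℝ) (R : Finset Lattice) :
    IntegrableOn (cauchyBornDensity R φ y) (interior (tri T)) := by
  refine IntegrableOn.congr_fun (f := fun _ => ∑ r ∈ R, φ ‖A.linear (site r)‖) ?_
    (fun x hx => (cauchyBornDensity_eq hA φ R hx).symm) isOpen_interior.measurableSet
  exact integrableOn_const (measure_ne_top_of_subset interior_subset
    (isCompact_tri T).measure_lt_top.ne)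

namespace IsTriangulation

variable {𝒯 : Finset (Finset Lattice)} {ω : Set Plane}

theorem ae_eq_iUnion_interior (h : IsTriangulation 𝒯 ω) :
    ω =ᵐ[volume] (⋃ T ∈ 𝒯, interior (tri T) : Set Plane) :=
  h.ae_eq_iUnion.trans
    (Filter.EventuallyEq.countable_bUnion 𝒯.countable_toSet fun T _ => (ae_eq_interior_tri T).symm)

theorem integrableOn_cauchyBornDensity (h : IsTriangulation 𝒯 ω) {y : Plane → Plane}
    {A : Finset Lattice → Plane →ᵃ[ℝ] Plane} (hA : ∀ T ∈ 𝒯, Set.EqOn y (A T) (tri T))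
    (φ : ℝ → ℝ) (R : Finset Lattice) : IntegrableOn (cauchyBornDensity R φ y) ω := by
  rw [integrableOn_congr_set_ae h.ae_eq_iUnion_interior, integrableOn_finset_iUnion]
  exact fun T hT => integrableOn_interior_cauchyBornDensity (hA T hT) φ R

theorem contEnergyTri_eq (h : IsTriangulation 𝒯 ω) {y : Plane → Plane}
    {A : Finset Lattice → Plane →ᵃ[ℝ] Plane} (hA : ∀ T ∈ 𝒯, Set.EqOn y (A T) (tri T))
    (φ : ℝ → ℝ) (R : Finset Lattice) :
    contEnergyTri 𝒯 R φ y
      = ∑ T ∈ 𝒯, ∑ r ∈ R, volume.real (tri T) * φ ‖(A T).linear (site r)‖ :=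
  Finset.sum_congr rfl fun T hT => Finset.sum_congr rfl fun r _ => by
    rw [dirDeriv_eq_linear_of_mem_interior (hA T hT)
      (barycenter_mem_interior (h.card_eq T hT) (h.nondegenerate T hT))]

theorem contEnergy_eq_contEnergyTri (h : IsTriangulation 𝒯 ω) {y : Plane → Plane}
    {A : Finset Lattice → Plane →ᵃ[ℝ] Plane} (hA : ∀ T ∈ 𝒯, Set.EqOn y (A T) (tri T))
    (φ : ℝ → ℝ) (R : Finset Lattice) :
    contEnergy ω R φ y = contEnergyTri 𝒯 R φ y := by
  rw [h.contEnergyTri_eq hA, contEnergy, setIntegral_congr_set h.ae_eq_iUnion_interior,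
    integral_biUnion_finset 𝒯 (fun T _ => isOpen_interior.measurableSet)
      (fun T hT T' hT' hne => h.nonoverlapping T hT T' hT' hne)
      (fun T hT => integrableOn_interior_cauchyBornDensity (hA T hT) φ R)]
  refine Finset.sum_congr rfl fun T hT => ?_
  rw [setIntegral_congr_fun isOpen_interior.measurableSet
    fun x hx => cauchyBornDensity_eq (hA T hT) φ R hx, setIntegral_const,
    measureReal_congr (ae_eq_interior_tri T), smul_eq_mul, Finset.mul_sum]

end IsTriangulation

/-! ### The representation of the ECC energy -/

/-- At every point of the open set `ω` the weight `chi` is `1`; the endpoints of the bond, possibly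
outside `ω`, are negligible. -/
theorem contContrib_eq_innerContContrib {ω : Set Plane} (hω : IsOpen ω) (φ : ℝ → ℝ)
    (y : Plane → Plane) {b : Lattice × Lattice} (hb : seg b ⊆ ω) :
    contContrib ω φ y b = innerContContrib φ y b := by
  simp only [contContrib, innerContContrib, bondAverage]
  rw [intervalIntegral.integral_of_le zero_le_one, intervalIntegral.integral_of_le zero_le_one,
    integral_Ioc_eq_integral_Ioo, integral_Ioc_eq_integral_Ioo]
  refine setIntegral_congr_fun measurableSet_Ioo fun t ht => ?_
  simp only [contDensity]
  rw [chi_eq_one (hω.mem_nhds (hb (bondPoint_mem_seg b ht))), one_mul]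

theorem outerBonds_union_innerBonds (Ω ω : Set Plane) (R : Finset Lattice) :
    outerBonds Ω ω R ∪ innerBonds Ω ω R = bonds Ω R := by
  ext b
  simp only [outerBonds, innerBonds, Set.mem_union, Set.mem_ofPred_eq]
  tauto

theorem disjoint_outerBonds_innerBonds (Ω ω : Set Plane) (R : Finset Lattice) :
    Disjoint (outerBonds Ω ω R) (innerBonds Ω ω R) :=
  Set.disjoint_left.2 fun _ h h' => h.2 h'.2

theorem eccEnergy_eq_sum_contContrib {Ω ω : Set Plane} (hω : IsOpen ω) (R : Finset Lattice)
    (φ : ℝ → ℝ) (y : Plane → Plane) :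
    eccEnergy Ω ω R φ y = (∑ᶠ b ∈ outerBonds Ω ω R, exactContrib φ y b)
      + ∑ᶠ b ∈ innerBonds Ω ω R, contContrib ω φ y b := by
  rw [eccEnergy]
  congr 1
  exact finsum_mem_congr rfl fun b hb => (contContrib_eq_innerContContrib hω φ y hb.2).symm

/-- The representation of the ECC energy by the Cauchy-Born energy and corrections. -/
theorem IsTriangulation.eccEnergy_eq {𝒯 : Finset (Finset Lattice)} {Ω ω : Set Plane}
    (h : IsTriangulation 𝒯 ω) (hΩ : Bornology.IsBounded Ω) {R : Finset Lattice}
    (hbdry : ∀ r ∈ R, ∀ i : Lattice, (seg (i, r) ∩ closure ω).Nonempty →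
      site i ∈ Ω ∧ site (i + r) ∈ Ω)
    {y : Plane → Plane} {A : Finset Lattice → Plane →ᵃ[ℝ] Plane}
    (hA : ∀ T ∈ 𝒯, Set.EqOn y (A T) (tri T)) (φ : ℝ → ℝ) :
    eccEnergy Ω ω R φ y
      = (∑ᶠ b ∈ outerBonds Ω ω R, (exactContrib φ y b - contContrib ω φ y b))
        + contEnergyTri 𝒯 R φ y := by
  have hfin := bonds_finite hΩ R
  have hout : (outerBonds Ω ω R).Finite := hfin.subset fun b hb => hb.1
  have hin : (innerBonds Ω ω R).Finite := hfin.subset fun b hb => hb.1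
  -- By `hbdry` every bond that meets `closure ω` is among the bonds summed here, so the weights are
  -- the full areas.
  have htotal : ∑ᶠ b ∈ bonds Ω R, contContrib ω φ y b = contEnergyTri 𝒯 R φ y := by
    rw [finsum_mem_eq_finite_toFinset_sum _ hfin,
      h.sum_contContrib hA φ (R := R) (fun b hb => (hfin.mem_toFinset.1 hb).1),
      h.contEnergyTri_eq hA]
    refine Finset.sum_congr rfl fun T hT => Finset.sum_congr rfl fun r hr => ?_
    rw [h.sum_bondFraction hT fun i hi => hfin.mem_toFinset.2 ⟨hr, hbdry r hr i hi⟩]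
  rw [← htotal, ← outerBonds_union_innerBonds Ω ω R,
    finsum_mem_union (disjoint_outerBonds_innerBonds Ω ω R) hout hin,
    finsum_mem_sub_distrib (f := exactContrib φ y) (g := contContrib ω φ y) hout,
    eccEnergy_eq_sum_contContrib h.isOpen]
  ring

/-! ### Straight-line computations and their cost -/

namespace Computation

/-- The sum of a list of computations. -/
def sumList : List Computation → Computation
  | [] => .const 0
  | p :: l => .add p (sumList l)

theorem value_sumList (φ : ℝ → ℝ) (y : Plane → Plane) (l : List Computation) :
    (sumList l).value φ y = (l.map fun p => p.value φ y).sum := by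
  induction l with
  | nil => rfl
  | cons p l ih => simp [sumList, value, ih]

/-- The `+ 1` pays for the addition that joins an entry to the sum. -/
theorem cost_sumList_le {l : List Computation} {c : ℕ} (h : ∀ p ∈ l, p.cost + 1 ≤ c) :
    (sumList l).cost ≤ c * l.length := by
  induction l with
  | nil => simp [sumList, cost]
  | cons p l ih =>
    have h1 := h p (by simp)
    have h2 := ih fun q hq => h q (by simp [hq])
    simp only [sumList, cost, List.length_cons]
    rw [mul_add, mul_one]
    omega

/-- The computation of the exact contribution of a bond. -/
def bond (b : Lattice × Lattice) : Computation :=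
  .potential (.sub (.coord (b.1 + b.2) 0) (.coord b.1 0))
    (.sub (.coord (b.1 + b.2) 1) (.coord b.1 1))

theorem value_bond (φ : ℝ → ℝ) (y : Plane → Plane) (b : Lattice × Lattice) :
    (bond b).value φ y = exactContrib φ y b := by
  simp only [bond, value, exactContrib]
  congr 2
  ext k
  fin_cases k <;> simp

/-- The coordinate `k` of `α (y_q - y_p) + β (y_s - y_p)`. -/
def gradientCoord (p q s : Lattice) (α β : ℝ) (k : Fin 2) : Computation :=
  .add (.mul (.const α) (.sub (.coord q k) (.coord p k)))
    (.mul (.const β) (.sub (.coord s k) (.coord p k)))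

/-- Expanding `r` in two edges of `T` expresses `D_r y` on `T` through differences of vertex values,
with coefficients depending on the geometry only. -/
theorem exists_computation_triangle {T : Finset Lattice} (hT : T.card = 3)
    (hT' : AffineIndependent ℝ fun v : T => site v) (r : Lattice) (c : ℝ) :
    ∃ Q : Computation, Q.cost = 12 ∧ ∀ (φ : ℝ → ℝ) (y : Plane → Plane) (A : Plane →ᵃ[ℝ] Plane),
      Set.EqOn y A (tri T) → Q.value φ y = c * φ ‖A.linear (site r)‖ := by
  obtain ⟨a, v, w, b, rfl, hb0, hb1, -⟩ := exists_frame hT hT'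
  set α := b.repr (site r) 0 with hα
  set β := b.repr (site r) 1 with hβ
  -- Five operations for each of the two coordinates, one potential and one product make `12`.
  refine ⟨.mul (.const c) (.potential (gradientCoord a (a + v) (a + w) α β 0)
    (gradientCoord a (a + v) (a + w) α β 1)), rfl, fun φ y A hA => ?_⟩
  have hmem : ∀ z ∈ ({a, a + v, a + w} : Finset Lattice), y (site z) = A (site z) := fun z hz =>
    hA (subset_convexHull ℝ _ ⟨z, hz, rfl⟩)
  have hlin : ∀ z, A (site (a + z)) - A (site a) = A.linear (site z) := by
    intro z
    rw [← vsub_eq_sub, ← A.linearMap_vsub, site_add, vsub_eq_sub, add_sub_cancel_left]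
  have hr : A.linear (site r) = α • (y (site (a + v)) - y (site a))
      + β • (y (site (a + w)) - y (site a)) := by
    rw [hmem a (by simp), hmem (a + v) (by simp), hmem (a + w) (by simp), hlin, hlin, ← hb0, ← hb1,
      ← A.linear.map_smul, ← A.linear.map_smul, ← A.linear.map_add]
    congr 1
    rw [← b.sum_repr (site r), Fin.sum_univ_two]
  rw [hr]
  simp only [value, gradientCoord]
  congr 3
  ext k
  fin_cases k <;> simp

end Computation

/-- The ECC energy has a straight-line computation with a bounded number of operations per bond
outside of the continuum region and per pair of a triangle and a neighbour. -/
theorem IsTriangulation.exists_computation {𝒯 : Finset (Finset Lattice)} {Ω ω : Set Plane}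
    (h : IsTriangulation 𝒯 ω) (hΩ : Bornology.IsBounded Ω) (R : Finset Lattice) :
    ∃ P : Computation,
      P.cost ≤ 20 * ((outerBonds Ω ω R).ncard + R.card * 𝒯.card) ∧
      ∀ (φ : ℝ → ℝ) (y : Plane → Plane), IsP1 𝒯 y → P.value φ y = eccEnergy Ω ω R φ y := by
  have hfin := bonds_finite hΩ R
  have hout : (outerBonds Ω ω R).Finite := hfin.subset fun b hb => hb.1
  have hin : (innerBonds Ω ω R).Finite := hfin.subset fun b hb => hb.1
  have hQ : ∀ (T : 𝒯) (r : Lattice), ∃ Q : Computation, Q.cost = 12 ∧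
      ∀ (φ : ℝ → ℝ) (y : Plane → Plane) (A : Plane →ᵃ[ℝ] Plane), Set.EqOn y A (tri T) →
        Q.value φ y = (∑ b ∈ hin.toFinset with b.2 = r, bondFraction T b)
          * φ ‖A.linear (site r)‖ := fun T r =>
    Computation.exists_computation_triangle (h.card_eq T T.2) (h.nondegenerate T T.2) r _
  choose Q hQcost hQvalue using hQ
  let l₁ : List Computation := hout.toFinset.toList.map Computation.bond
  let l₂ : List Computation := (𝒯.attach ×ˢ R).toList.map fun p => Q p.1 p.2
  refine ⟨Computation.sumList (l₁ ++ l₂), ?_, fun φ y hy => ?_⟩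
  -- With the addition included, a bond costs `4` and a pair of a triangle and a direction costs
  -- `13`; both are below `20`.
  · refine (Computation.cost_sumList_le (c := 20) fun p hp => ?_).trans_eq ?_
    · rcases List.mem_append.1 hp with hp | hp
      · obtain ⟨b, -, rfl⟩ := List.mem_map.1 hp
        simp [Computation.bond, Computation.cost]
      · obtain ⟨q, -, rfl⟩ := List.mem_map.1 hp
        simp [hQcost]
    · simp only [l₁, l₂, List.length_append, List.length_map, Finset.length_toList,
        Finset.card_product, Finset.card_attach]
      rw [Set.ncard_eq_toFinset_card _ hout, mul_comm R.card]
  · choose A hA using hy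
    let A' : Finset Lattice → Plane →ᵃ[ℝ] Plane := fun T => if hT : T ∈ 𝒯 then A T hT else 0
    have hA' : ∀ T ∈ 𝒯, Set.EqOn y (A' T) (tri T) := fun T hT => by
      simpa [A', hT] using hA T hT
    rw [Computation.value_sumList, eccEnergy_eq_sum_contContrib h.isOpen,
      finsum_mem_eq_finite_toFinset_sum _ hout, finsum_mem_eq_finite_toFinset_sum _ hin,
      h.sum_contContrib hA' φ (R := R) (fun b hb => (hin.mem_toFinset.1 hb).1.1),
      List.map_append, List.sum_append]
    congr 1
    · simp only [l₁, List.map_map, Function.comp_def, Computation.value_bond]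
      exact Finset.sum_map_toList _ _
    · simp only [l₂, List.map_map, Function.comp_def]
      rw [Finset.sum_map_toList, Finset.sum_product, ← Finset.sum_attach 𝒯]
      exact Finset.sum_congr rfl fun T _ => Finset.sum_congr rfl fun r _ =>
        hQvalue T r φ y (A' T) (hA' T T.2)

end ECC

theorem theorem4p3
    -- the regions: the body, the atomistic region, and the continuum region
    (Ω Ωa Ωc : Set ECC.Plane)
    (hΩ_open : IsOpen Ω) (hΩ_bdd : Bornology.IsBounded Ω)
    (hΩa_open : IsOpen Ωa) (hΩa_sub : Ωa ⊆ Ω) (hΩc : Ωc = Ω \ closure Ωa)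
    -- the lattice-vertex triangulation of the polygonal continuum region
    (𝒯 : Finset (Finset ECC.Lattice)) (h𝒯 : ECC.IsTriangulation 𝒯 Ωc)
    -- the set of neighbours
    (R : Finset ECC.Lattice) (hR : (0 : ECC.Lattice) ∉ R)
    -- every bond that meets the closed continuum region has both its ends in the body
    (hbdry : ∀ r ∈ R, ∀ i : ECC.Lattice, (ECC.seg (i, r) ∩ closure Ωc).Nonempty →
      ECC.site i ∈ Ω ∧ ECC.site (i + r) ∈ Ω) :
    (∀ (φ : ℝ → ℝ) (y : ECC.Plane → ECC.Plane), ECC.IsP1 𝒯 y →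
      -- the contributions `c_b` are well defined, and extend those of the bonds inside `Ωc`
      (∀ b ∈ ECC.bonds Ω R, IntervalIntegrable
        (fun t => ECC.contDensity Ωc φ y b (ECC.bondPoint b t)) MeasureTheory.volume 0 1) ∧
      (∀ b ∈ ECC.innerBonds Ω Ωc R,
        ECC.contContrib Ωc φ y b = ECC.innerContContrib φ y b) ∧
      -- the two expressions of the Cauchy-Born energy agree
      MeasureTheory.IntegrableOn (ECC.cauchyBornDensity R φ y) Ωc ∧
      ECC.contEnergy Ωc R φ y = ECC.contEnergyTri 𝒯 R φ y ∧
      -- the representation of the ECC energy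
      ECC.eccEnergy Ω Ωc R φ y =
        (∑ᶠ b ∈ ECC.outerBonds Ω Ωc R, (ECC.exactContrib φ y b - ECC.contContrib Ωc φ y b))
          + ECC.contEnergyTri 𝒯 R φ y) ∧
    -- the cost of computing the ECC energy
    (∃ P : ECC.Computation,
      P.cost ≤ 20 * ((ECC.outerBonds Ω Ωc R).ncard + R.card * 𝒯.card) ∧
      ∀ (φ : ℝ → ℝ) (y : ECC.Plane → ECC.Plane), ECC.IsP1 𝒯 y →
        P.value φ y = ECC.eccEnergy Ω Ωc R φ y) := by
  refine ⟨fun φ y hy => ?_, h𝒯.exists_computation hΩ_bdd R⟩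
  choose A hA using hy
  let A' : Finset ECC.Lattice → ECC.Plane →ᵃ[ℝ] ECC.Plane :=
    fun T => if hT : T ∈ 𝒯 then A T hT else 0
  have hA' : ∀ T ∈ 𝒯, Set.EqOn y (A' T) (ECC.tri T) := fun T hT => by
    simpa [A', hT] using hA T hT
  exact ⟨fun b _ => h𝒯.intervalIntegrable_contDensity hA' φ b,
    fun b hb => ECC.contContrib_eq_innerContContrib h𝒯.isOpen φ y hb.2,
    h𝒯.integrableOn_cauchyBornDensity hA' φ R, h𝒯.contEnergy_eq_contEnergyTri hA' φ R,
    h𝒯.eccEnergy_eq hΩ_bdd hbdry hA' φ⟩
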